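/- **P3DM.** An instance consists of three pairwise disjoint finite sets $X,Y,Z$ with $|X|=|Y|=|Z|=q$ and a set $T\subseteq X\times Y\times Z$ such that every element of $X\cup Y\cup Z$ occurs in at most three triples of $T$ and the bipartite graph joining each triple of $T$ to its three elements is planar. The answer is YES if there is $T'\subseteq T$ such that every element of $X\cup Y\cup Z$ is contained in exactly one triple of $T'$. **UC3P.** An instance consists of three discrete probability measures $P_1,P_2,P_3$ in the Euclidean plane, each with $n$ support points (points with equal coordinates may be listed separately) of mass $1/n$ each, a bound $N\in\mathbb N$ and a bound $\Phi$. A *combination measure* $P^*$ assigns masses $w_s\ge 0$ to the triples $s=(x_1,x_2,x_3)$ of support points $x_i$ of $P_i$, such that for each $i$ and each support point $p$ of $P_i$ the masses of the triples with $x_i=p$ add up to $1/n$, and such that different triples of positive mass have different means. Its support points are the means $\bar x_s=\frac13(x_1+x_2+x_3)$ of the triples with $w_s>0$, and its transport cost is $\phi(P^*)=\sum_s w_s\sum_{i=1}^3\frac13\|\bar x_s-x_i\|^2$. The answer is YES if some combination measure has at most $N$ support points and transport cost at most $\Phi$. **Triangle path graphs.** A *3-4-5 triangle* is a right triangle with side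 lengths $3,4,5$ with one horizontal and one vertical leg. A triangle path graph $G_{TP}$ of a P3DM instance consists of points with integer coordinates in the plane, each assigned to one of three sets $P_1,P_2,P_3$, namely an *element point* for every $e\in X\cup Y\cup Z$ and, for every $t\in T$ and every element $e$ of $t$, the vertices of a *triangle path*, as follows. 1. A path is a sequence of at least two *pairs*. A pair is a $3\times4$ or $4\times 3$ axis-parallel rectangle with vertices $s,a,b,s'$, where $s,s'$ are opposite, divided into the 3-4-5 triangles $sab$ and $abs'$. The first pair of the path of $(e,t)$ has $s$ equal to the element point $e$; every later pair has $s$ equal to the vertex $s'$ of the previous pair. Each pair contributes its own three vertices $a,b,s'$, which are listed separately even where coordinates agree. 2. The first pair of each path is vertical (side of length $4$ vertical); the second is horizontal and has only one point in common with the first. 3. For each $t\in T$ the final vertices $s'$ of the three paths leading to $t$ form a 3-4-5 triangle, the *triple triangle* of $t$. 4. Two different vertices have equal coordinates only if they are vertices of type $a$ or $b$ of two pairs that are consecutive in a path or that are the first pairs of two paths with the same element point. Vertices with equal coordinates belong to the same set. 5. The vertices of each triangle $sab$, $abs'$ and of each triple triangle belong to three different sets, and each of the three sets contains $q$ element points.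 6. Vertices with different coordinates are at least $3$ apart, and no three vertices from three different sets form a right triangle with two legs of length $3$. 7. Two points of one path that do not lie on one pair or on two consecutive pairs are at least $6$ apart. Any three vertices from three different sets that do not all lie (by coordinates) on one path contain two vertices at least $6$ apart, unless they form a triple triangle or consist of an element point and vertices of first pairs of paths starting at it. Then each of $P_1,P_2,P_3$ has the same number $n$ of points, namely $q$ plus the total number of pairs. **Theorem.** Let a P3DM instance and a triangle path graph $G_{TP}$ of it be given, and take the UC3P instance whose measures are the uniform measures on the $n$-point lists $P_1,P_2,P_3$ of $G_{TP}$, with $N=n$ and $\Phi=50/9$. This UC3P instance has answer YES if and only if the P3DM instance has answer YES. -/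

import Mathlib

open Finset

noncomputable section

/-- The Euclidean plane. -/
abbrev Plane : Type := EuclideanSpace ℝ (Fin 2)

/-! ### Planar graphs -/

/-- A graph is planar if it can be drawn in the plane: distinct vertices go to distinct points,
every edge to a simple arc joining its endpoints, and an arc meets the vertices and the other
arcs at most in its own endpoints. -/
def IsPlanarGraph {V : Type*} (G : SimpleGraph V) : Prop :=
  ∃ (pos : V → Plane) (arc : Sym2 V → unitInterval → Plane),
    Function.Injective pos ∧
    (∀ e ∈ G.edgeSet, Continuous (arc e) ∧ Function.Injective (arc e)) ∧
    (∀ u v, G.Adj u v →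
      (arc s(u, v) 0 = pos u ∧ arc s(u, v) 1 = pos v) ∨
      (arc s(u, v) 0 = pos v ∧ arc s(u, v) 1 = pos u)) ∧
    (∀ e ∈ G.edgeSet, ∀ r ∈ Set.Ioo (0 : unitInterval) 1, ∀ v, arc e r ≠ pos v) ∧
    (∀ e ∈ G.edgeSet, ∀ e' ∈ G.edgeSet, e ≠ e' →
      ∀ r ∈ Set.Ioo (0 : unitInterval) 1, ∀ r' ∈ Set.Ioo (0 : unitInterval) 1,
        arc e r ≠ arc e' r')

/-! ### Planar three-dimensional matching -/

/-- The elements of the disjoint union of `X`, `Y` and `Z`. -/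
abbrev Element (X Y Z : Type*) := X ⊕ Y ⊕ Z

/-- The three elements of a triple. -/
def tripleElement {X Y Z : Type*} (t : X × Y × Z) : Fin 3 → Element X Y Z :=
  ![Sum.inl t.1, Sum.inr (Sum.inl t.2.1), Sum.inr (Sum.inr t.2.2)]

/-- The element `e` occurs in the triple `t`. -/
def OccursIn {X Y Z : Type*} (e : Element X Y Z) (t : X × Y × Z) : Prop :=
  ∃ i, tripleElement t i = e

/-- The bipartite graph with a vertex for every element and for every triple of `T`, in which a
triple is joined to the three elements that occur in it. -/
def incidenceGraph {X Y Z : Type*} (T : Finset (X × Y × Z)) :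
    SimpleGraph (Element X Y Z ⊕ T) :=
  SimpleGraph.fromRel fun a b => ∃ (e : Element X Y Z) (t : T),
    a = Sum.inl e ∧ b = Sum.inr t ∧ OccursIn e t.1

/-- An instance of planar three-dimensional matching on the ground sets `X`, `Y`, `Z`. -/
structure P3DM (X Y Z : Type*) [Fintype X] [Fintype Y] [Fintype Z] where
  /-- the given triples -/
  T : Finset (X × Y × Z)
  card_X_eq_card_Y : Fintype.card X = Fintype.card Y
  card_Y_eq_card_Z : Fintype.card Y = Fintype.card Z
  occurs_le_three : ∀ e : Element X Y Z, {t | t ∈ T ∧ OccursIn e t}.ncard ≤ 3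
  planar : IsPlanarGraph (incidenceGraph T)

/-- Some subset of the triples contains every element in exactly one triple. -/
def P3DM.IsYes {X Y Z : Type*} [Fintype X] [Fintype Y] [Fintype Z] (D : P3DM X Y Z) : Prop :=
  ∃ T' ⊆ D.T, ∀ e : Element X Y Z, ∃! t, t ∈ T' ∧ OccursIn e t

/-! ### The uniform combination 3-measure problem -/

/-- Three discrete probability measures in the plane: the `i`-th one has `n` support points
`point i p`, each of mass `1 / n`. Support points of one measure may have equal coordinates;
they are told apart by their index `p`. -/
structure UC3P where
  /-- the number of support points of each of the measures -/
  n : ℕ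
  /-- the index sets of the support points -/
  ι : Fin 3 → Type*
  [fintype : ∀ i, Fintype (ι i)]
  card_eq : ∀ i, Fintype.card (ι i) = n
  /-- the coordinates of the support points -/
  point : ∀ i, ι i → Plane

namespace UC3P

attribute [instance] UC3P.fintype

variable (U : UC3P)

/-- A tuple takes one support point from each of the measures. -/
abbrev Tuple := ∀ i, U.ι i

/-- The weighted mean of a tuple, with the weights `1 / 3`. -/
def mean (s : U.Tuple) : Plane := ∑ i, (1 / 3 : ℝ) • U.point i (s i)

/-- The cost of transporting a unit of mass from the weighted mean of a tuple to its points. -/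
def cost (s : U.Tuple) : ℝ := ∑ i, (1 / 3 : ℝ) * ‖U.mean s - U.point i (s i)‖ ^ 2

/-- A combination measure: masses on tuples that add up to the given measures, such that every
support point, that is, the weighted mean of a tuple of positive mass, sends its mass to one
tuple only. -/
structure CombinationMeasure where
  /-- the mass of a tuple -/
  mass : U.Tuple → ℝ
  mass_nonneg : ∀ s, 0 ≤ mass s
  marginal : ∀ i (p : U.ι i), (open Classical in ∑ s with s i = p, mass s) = 1 / (U.n : ℝ)
  mean_injOn : Set.InjOn U.mean {s | 0 < mass s}

variable {U}

/-- The support points of a combination measure. -/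
def CombinationMeasure.supp (P : U.CombinationMeasure) : Set Plane :=
  U.mean '' {s | 0 < P.mass s}

/-- The transport cost of a combination measure. -/
def CombinationMeasure.totalCost (P : U.CombinationMeasure) : ℝ :=
  ∑ s, U.cost s * P.mass s

variable (U)

/-- Some combination measure has at most `N` support points and transport cost at most `Φ`. -/
def IsYes (N : ℕ) (Φ : ℝ) : Prop :=
  ∃ P : U.CombinationMeasure, P.supp.ncard ≤ N ∧ P.totalCost ≤ Φ

end UC3P

/-! ### Triangle path graphs -/

/-- The squared Euclidean distance of two points with integer coordinates. -/
def sqDist (p q : ℤ × ℤ) : ℤ := (p.1 - q.1) ^ 2 + (p.2 - q.2) ^ 2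

/-- The points `c, h, v` form a 3-4-5 triangle with vertical and horizontal legs, with the right
angle at `c`, with `h` the end of the horizontal leg and `v` the end of the vertical leg. -/
def Corner345 (c h v : ℤ × ℤ) : Prop :=
  h.2 = c.2 ∧ v.1 = c.1 ∧
    ((|h.1 - c.1| = 3 ∧ |v.2 - c.2| = 4) ∨ (|h.1 - c.1| = 4 ∧ |v.2 - c.2| = 3))

/-- Three points form a 3-4-5 triangle with vertical and horizontal legs. -/
def Is345 (f : Fin 3 → ℤ × ℤ) : Prop :=
  ∃ σ : Equiv.Perm (Fin 3), Corner345 (f (σ 0)) (f (σ 1)) (f (σ 2))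

section TrianglePaths

variable {X Y Z : Type*} [Fintype X] [Fintype Y] [Fintype Z]

/-- The edges of the incidence graph: `(t, i)` joins the triple `t` to its `i`-th element. -/
abbrev P3DM.Edge (D : P3DM X Y Z) := D.T × Fin 3

/-- The element at which an edge starts. -/
def P3DM.Edge.element {D : P3DM X Y Z} (π : D.Edge) : Element X Y Z := tripleElement π.1.1 π.2

/-- The element points, and a triangle path for every edge. The path `π` consists of `len π`
rectangular pairs of triangles; the pair `k` has the vertices `start`, `hor`, `ver`, `finish`, and
its two triangles are `start, hor, ver` and `hor, ver, finish`. The first pair starts at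
the element point and every later pair starts at the finish of the previous one, so that each pair
contributes the three new vertices `hor`, `ver`, `finish`. Different vertices may have equal
coordinates. -/
structure TrianglePaths (D : P3DM X Y Z) where
  /-- the number of pairs of triangles of a path -/
  len : D.Edge → ℕ
  two_le_len : ∀ π, 2 ≤ len π
  /-- the coordinates of the vertices -/
  loc : Element X Y Z ⊕ (Σ π : D.Edge, Fin (len π) × Fin 3) → ℤ × ℤ
  /-- the one of the three sets to which a vertex is assigned -/
  part : Element X Y Z ⊕ (Σ π : D.Edge, Fin (len π) × Fin 3) → Fin 3

namespace TrianglePaths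

variable {D : P3DM X Y Z} (G : TrianglePaths D)

/-- The vertices: the element points and the three new vertices of every pair of triangles. -/
abbrev Vertex := Element X Y Z ⊕ (Σ π : D.Edge, Fin (G.len π) × Fin 3)

/-- The new vertex of a pair on the horizontal line through its start. -/
def hor (π : D.Edge) (k : Fin (G.len π)) : G.Vertex := Sum.inr ⟨π, k, 0⟩

/-- The new vertex of a pair on the vertical line through its start. -/
def ver (π : D.Edge) (k : Fin (G.len π)) : G.Vertex := Sum.inr ⟨π, k, 1⟩

/-- The vertex of a pair opposite to its start. -/
def finish (π : D.Edge) (k : Fin (G.len π)) : G.Vertex := Sum.inr ⟨π, k, 2⟩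

/-- The vertex at which a pair starts. -/
def start (π : D.Edge) (k : Fin (G.len π)) : G.Vertex :=
  if k.1 = 0 then Sum.inl π.element
  else G.finish π ⟨k.1 - 1, lt_of_le_of_lt (Nat.sub_le _ _) k.2⟩

/-- The four vertices of a pair. -/
def corner (π : D.Edge) (k : Fin (G.len π)) : Fin 4 → G.Vertex :=
  ![G.start π k, G.hor π k, G.ver π k, G.finish π k]

/-- The first pair of a path. -/
def first (π : D.Edge) : Fin (G.len π) := ⟨0, lt_of_lt_of_le (by decide) (G.two_le_len π)⟩

/-- The second pair of a path. -/
def second (π : D.Edge) : Fin (G.len π) := ⟨1, lt_of_lt_of_le (by decide) (G.two_le_len π)⟩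

/-- The last pair of a path. -/
def last (π : D.Edge) : Fin (G.len π) :=
  ⟨G.len π - 1, Nat.sub_lt (lt_of_lt_of_le (by decide) (G.two_le_len π)) (by decide)⟩

/-- The vertices of the triple triangle of `t`: the ends of the three paths that lead to `t`. The
`i`-th one represents the `i`-th element of `t`. -/
def tripleVertex (t : D.T) (i : Fin 3) : G.Vertex := G.finish (t, i) (G.last (t, i))

/-- The longer edge of the pair is vertical. -/
def IsVertical (π : D.Edge) (k : Fin (G.len π)) : Prop :=
  |(G.loc (G.ver π k)).2 - (G.loc (G.start π k)).2| = 4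

/-- The longer edge of the pair is horizontal. -/
def IsHorizontal (π : D.Edge) (k : Fin (G.len π)) : Prop :=
  |(G.loc (G.hor π k)).1 - (G.loc (G.start π k)).1| = 4

/-- The three vertices belong to three different sets. -/
def Feasible (u v w : G.Vertex) : Prop :=
  G.part u ≠ G.part v ∧ G.part u ≠ G.part w ∧ G.part v ≠ G.part w

/-- The squared distance of two vertices. -/
def sqd (u v : G.Vertex) : ℤ := sqDist (G.loc u) (G.loc v)

/-- The vertex lies on the path `π`, up to equality of coordinates. -/
def OnPath (π : D.Edge) (u : G.Vertex) : Prop := ∃ k j, G.loc u = G.loc (G.corner π k j)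

/-- The vertex belongs to the first pair of some path that starts at the element `e`. -/
def OnFirstPair (e : Element X Y Z) (u : G.Vertex) : Prop :=
  ∃ π : D.Edge, π.element = e ∧ ∃ j, u = G.corner π (G.first π) j

/-- `u` and `v` are two vertices, neither of them the start or the finish of its pair, of two pairs
that meet in a start or finish: two consecutive pairs of one path or the first pairs of two
paths that start at the same element point. -/
def IsDuplicate (u v : G.Vertex) : Prop :=
  ∃ (π π' : D.Edge) (k : Fin (G.len π)) (k' : Fin (G.len π')),
    (u = G.hor π k ∨ u = G.ver π k) ∧ (v = G.hor π' k' ∨ v = G.ver π' k') ∧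
    (G.start π k = G.start π' k' ∨ G.finish π k = G.start π' k' ∨ G.finish π' k' = G.start π k)

end TrianglePaths

/-- A triangle path graph of an instance of planar three-dimensional matching. -/
structure TrianglePathGraph (D : P3DM X Y Z) extends TrianglePaths D where
  /-- every pair is a rectangle made of two 3-4-5 triangles with a common longest side -/
  pair_start : ∀ π k, Corner345 (loc (toTrianglePaths.start π k))
    (loc (toTrianglePaths.hor π k)) (loc (toTrianglePaths.ver π k))
  pair_finish : ∀ π k, Corner345 (loc (toTrianglePaths.finish π k))
    (loc (toTrianglePaths.ver π k)) (loc (toTrianglePaths.hor π k))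
  /-- the first pair of a path is vertical -/
  first_vertical : ∀ π, toTrianglePaths.IsVertical π (toTrianglePaths.first π)
  /-- the second pair of a path is horizontal -/
  second_horizontal : ∀ π, toTrianglePaths.IsHorizontal π (toTrianglePaths.second π)
  /-- the second pair of a path meets the first one in just one vertex -/
  second_meets_first : ∀ π i j,
    loc (toTrianglePaths.corner π (toTrianglePaths.first π) i) =
      loc (toTrianglePaths.corner π (toTrianglePaths.second π) j) → i = 3 ∧ j = 0
  /-- the triple triangles are 3-4-5 triangles -/
  triple_triangle : ∀ t, Is345 fun i => loc (toTrianglePaths.tripleVertex t i)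
  /-- equal coordinates occur only for duplicate vertices -/
  duplicate : ∀ u v, u ≠ v → loc u = loc v → toTrianglePaths.IsDuplicate u v
  /-- the three sets are disjoint as sets of points of the plane -/
  part_eq : ∀ u v, loc u = loc v → part u = part v
  /-- every 3-4-5 triangle of the construction has one vertex in each of the three sets -/
  feasible_start : ∀ π k, toTrianglePaths.Feasible (toTrianglePaths.start π k)
    (toTrianglePaths.hor π k) (toTrianglePaths.ver π k)
  feasible_finish : ∀ π k, toTrianglePaths.Feasible (toTrianglePaths.hor π k)
    (toTrianglePaths.ver π k) (toTrianglePaths.finish π k)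
  feasible_triple : ∀ t, toTrianglePaths.Feasible (toTrianglePaths.tripleVertex t 0)
    (toTrianglePaths.tripleVertex t 1) (toTrianglePaths.tripleVertex t 2)
  /-- each of the three sets contains the same number of element points -/
  part_element : ∀ c, {e : Element X Y Z | part (Sum.inl e) = c}.ncard = Fintype.card X
  /-- different points are at least 3 apart -/
  three_le_dist : ∀ u v, loc u ≠ loc v → 3 ^ 2 ≤ toTrianglePaths.sqd u v
  /-- a right triangle with two legs of length 3 has two vertices in the same set -/
  not_feasible_of_legs : ∀ u v w, toTrianglePaths.sqd u v = 3 ^ 2 →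
    toTrianglePaths.sqd u w = 3 ^ 2 → toTrianglePaths.sqd v w = 3 ^ 2 + 3 ^ 2 →
    ¬ toTrianglePaths.Feasible u v w
  /-- a path keeps away from itself: two of its vertices that do not lie on a common pair or on
  two consecutive pairs are at least 6 apart -/
  path_spacing : ∀ π u v, toTrianglePaths.OnPath π u → toTrianglePaths.OnPath π v →
    (∃ k k' : Fin (len π), k.1 ≤ k'.1 + 1 ∧ k'.1 ≤ k.1 + 1 ∧
      (∃ j, loc u = loc (toTrianglePaths.corner π k j)) ∧
      (∃ j, loc v = loc (toTrianglePaths.corner π k' j))) ∨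
    6 ^ 2 ≤ toTrianglePaths.sqd u v
  /-- the paths keep away from each other: three vertices in different sets that do not lie on
  one path contain two vertices at least 6 apart, unless they are the vertices of a triple
  triangle, or an element point and vertices of the first pairs of the paths starting there -/
  spacing : ∀ u v w, toTrianglePaths.Feasible u v w →
    (∃ π, toTrianglePaths.OnPath π u ∧ toTrianglePaths.OnPath π v ∧ toTrianglePaths.OnPath π w) ∨
    (∃ e, Sum.inl e ∈ ({u, v, w} : Set _) ∧
      ∀ a ∈ ({u, v, w} : Set _), toTrianglePaths.OnFirstPair e a) ∨
    (∃ t, ({u, v, w} : Set _) = Set.range (toTrianglePaths.tripleVertex t)) ∨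
    6 ^ 2 ≤ toTrianglePaths.sqd u v ∨ 6 ^ 2 ≤ toTrianglePaths.sqd u w ∨
    6 ^ 2 ≤ toTrianglePaths.sqd v w

namespace TrianglePathGraph

variable {D : P3DM X Y Z} (G : TrianglePathGraph D)

/-- The number of points in each of the three sets. -/
def n : ℕ := Fintype.card X + ∑ π, G.len π

lemma part_pair_bijective (π : D.Edge) (k : Fin (G.len π)) :
    Function.Bijective fun j : Fin 3 => G.part (Sum.inr ⟨π, k, j⟩) := by
  have h := G.feasible_finish π k
  simp only [TrianglePaths.Feasible, TrianglePaths.hor, TrianglePaths.ver,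
    TrianglePaths.finish] at h
  rw [← Finite.injective_iff_bijective]
  obtain ⟨h₀, h₁, h₂⟩ := h
  have key : ∀ f : Fin 3 → Fin 3, f 0 ≠ f 1 → f 0 ≠ f 2 → f 1 ≠ f 2 → Function.Injective f := by
    decide
  exact key _ h₀ h₁ h₂

lemma card_part (c : Fin 3) : Fintype.card {v : G.Vertex // G.part v = c} = G.n := by
  have h : ∀ (π : D.Edge) (k : Fin (G.len π)),
      (∑ j : Fin 3, if G.part (Sum.inr ⟨π, k, j⟩) = c then 1 else 0) = 1 := by
    intro π k
    obtain ⟨j, hj, hu⟩ := (G.part_pair_bijective π k).existsUnique c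
    rw [Finset.sum_eq_single j]
    · simp only [hj, if_true]
    · intro i _ hi
      exact if_neg fun h => hi (hu i h)
    · simp
  have h' := G.part_element c
  rw [Set.ncard_eq_toFinset_card', Set.toFinset_ofPred] at h'
  rw [Fintype.card_subtype, Finset.card_filter, Fintype.sum_sum_type, ← Finset.card_filter, h',
    Fintype.sum_sigma]
  unfold n
  congr 1
  refine Finset.sum_congr rfl fun π _ => ?_
  rw [Fintype.sum_prod_type]
  simp only [h, Finset.sum_const, Finset.card_univ, Fintype.card_fin, smul_eq_mul, mul_one]

/-- The instance of the uniform combination 3-measure problem: the support points of the `c`-th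
measure are the vertices in the `c`-th set. -/
def toUC3P : UC3P where
  n := G.n
  ι c := {v : G.Vertex // G.part v = c}
  card_eq := G.card_part
  point _ v := !₂[((G.loc v.1).1 : ℝ), ((G.loc v.1).2 : ℝ)]

end TrianglePathGraph

end TrianglePaths

end

/-!
A tuple takes one vertex from each of `P₁`, `P₂`, `P₃`. Its cost is a ninth of the sum of the
squared distances of its vertices, and this sum is at least `50`, with equality only for two kinds
of tuples: those inside the region of one element (its element point and the paths starting there),
and the vertices of the triple triangles. As the total mass is `1`, a combination measure of cost
at most `50 / 9` uses tuples of cost `50 / 9` only, and having at most `n` support points forces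
every vertex to lie in exactly one of these tuples.

From such a system of tuples a matching is obtained by counting: in the region of an element `e`,
the set of `e` has one vertex more than each of the other two sets, so exactly one tuple leaves the
region, and it is the triple triangle of a triple that contains `e`. Conversely, given a matching,
take the triple triangles of its triples, the triangle `start, hor, ver` of every pair on a path to
one of its triples, and the triangle `hor, ver, finish` of every other pair. They cover each vertex
exactly once. The right angles of two 3-4-5 triangles with equal means are less than 3 apart, hence
equal, so the triangles coincide; therefore the means of different chosen triangles differ.
-/

/-! ### Distances of lattice points -/

lemma sqDist_comm (p q : ℤ × ℤ) : sqDist p q = sqDist q p := by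
  unfold sqDist; ring

lemma sqDist_swap (p q : ℤ × ℤ) : sqDist p.swap q.swap = sqDist p q := by
  unfold sqDist; exact add_comm _ _

lemma sqDist_le_two_mul_add (p q r : ℤ × ℤ) : sqDist p q ≤ 2 * (sqDist p r + sqDist q r) := by
  unfold sqDist
  nlinarith [sq_nonneg (p.1 + q.1 - 2 * r.1), sq_nonneg (p.2 + q.2 - 2 * r.2)]

lemma norm_sub_sq_eq_sqDist (p q : ℤ × ℤ) :
    ‖(!₂[(p.1 : ℝ), (p.2 : ℝ)] : Plane) - !₂[(q.1 : ℝ), (q.2 : ℝ)]‖ ^ 2 = sqDist p q := by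
  simp [EuclideanSpace.norm_sq_eq, sqDist]

lemma sq_eq_of_abs_eq_three_or_four {x : ℤ} (h : |x| = 3 ∨ |x| = 4) :
    x ^ 2 = 3 ^ 2 ∨ x ^ 2 = 4 ^ 2 := by
  rw [← sq_abs]
  exact h.imp (congrArg (· ^ 2)) (congrArg (· ^ 2))

lemma six_sq_le_add_sq {x y : ℤ} (hx : |x| = 3 ∨ |x| = 4) (hy : |y| = 3 ∨ |y| = 4)
    (hxy : 3 ^ 2 ≤ (x + y) ^ 2) : 6 ^ 2 ≤ (x + y) ^ 2 := by
  rw [sq_le_sq] at hxy ⊢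
  rw [abs_of_nonneg (by norm_num : (0 : ℤ) ≤ 3)] at hxy
  rw [abs_of_nonneg (by norm_num : (0 : ℤ) ≤ 6)]
  have := abs_cases x
  have := abs_cases y
  have := abs_cases (x + y)
  omega

/-- The sum of the squared side lengths of a triangle. -/
def sqSpread (f : Fin 3 → ℤ × ℤ) : ℤ := ∑ i, sqDist (f i) (f (i + 1))

lemma sqSpread_eq (f : Fin 3 → ℤ × ℤ) {a b c : Fin 3} (hab : a ≠ b) (hac : a ≠ c) (hbc : b ≠ c) :
    sqSpread f = sqDist (f a) (f b) + sqDist (f a) (f c) + sqDist (f b) (f c) := by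
  have h₀₁ := sqDist_comm (f 0) (f 1)
  have h₀₂ := sqDist_comm (f 0) (f 2)
  have h₁₂ := sqDist_comm (f 1) (f 2)
  fin_cases a <;> fin_cases b <;> fin_cases c <;>
    simp [sqSpread, Fin.sum_univ_three] at hab hac hbc ⊢ <;> linarith

lemma fifty_lt_sqSpread_of_far {f : Fin 3 → ℤ × ℤ} {a b : Fin 3} (hab : a ≠ b)
    (h : 6 ^ 2 ≤ sqDist (f a) (f b)) : 50 < sqSpread f := by
  obtain ⟨c, hac, hbc⟩ : ∃ c, a ≠ c ∧ b ≠ c := by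
    clear h
    decide +revert
  have := sqDist_le_two_mul_add (f a) (f b) (f c)
  linarith [sqSpread_eq f hab hac hbc]

/-! ### 3-4-5 triangles -/

/-- The point `q` is obtained from `p` by a horizontal or vertical step of length 3 or 4, as for two
adjacent vertices of a `3 × 4` rectangle. -/
def AxisStep (p q : ℤ × ℤ) : Prop :=
  (q.2 = p.2 ∧ (|q.1 - p.1| = 3 ∨ |q.1 - p.1| = 4)) ∨
    (q.1 = p.1 ∧ (|q.2 - p.2| = 3 ∨ |q.2 - p.2| = 4))

namespace Corner345

variable {c h v : ℤ × ℤ}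

lemma swap (H : Corner345 c h v) : Corner345 c.swap v.swap h.swap :=
  ⟨H.2.1, H.1, H.2.2.symm.imp And.symm And.symm⟩

lemma abs_hor (H : Corner345 c h v) : |h.1 - c.1| = 3 ∨ |h.1 - c.1| = 4 :=
  H.2.2.imp And.left And.left

lemma abs_ver (H : Corner345 c h v) : |v.2 - c.2| = 3 ∨ |v.2 - c.2| = 4 :=
  H.swap.abs_hor

lemma abs_hor_le (H : Corner345 c h v) : |h.1 - c.1| ≤ 4 :=
  H.abs_hor.elim (fun e => by rw [e]; norm_num) le_of_eq

lemma abs_ver_le (H : Corner345 c h v) : |v.2 - c.2| ≤ 4 := H.swap.abs_hor_le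

lemma axisStep_hor (H : Corner345 c h v) : AxisStep c h := Or.inl ⟨H.1, H.abs_hor⟩

lemma axisStep_ver (H : Corner345 c h v) : AxisStep c v := Or.inr ⟨H.2.1, H.abs_ver⟩

lemma sum_sqDist (H : Corner345 c h v) : sqDist c h + sqDist c v + sqDist h v = 50 := by
  obtain ⟨hc, vc, H⟩ := H
  have legs : (h.1 - c.1) ^ 2 + (v.2 - c.2) ^ 2 = 25 := by
    rw [← sq_abs (h.1 - c.1), ← sq_abs (v.2 - c.2)]
    rcases H with ⟨e₁, e₂⟩ | ⟨e₁, e₂⟩ <;> rw [e₁, e₂] <;> norm_num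
  simp only [sqDist, hc, vc]
  linarith

lemma eq_of_sum_eq {c' h' v' : ℤ × ℤ} (H : Corner345 c h v) (H' : Corner345 c' h' v')
    (far : c ≠ c' → 3 ^ 2 ≤ sqDist c c') (hsum : c + h + v = c' + h' + v') :
    c = c' ∧ h = h' ∧ v = v' := by
  obtain ⟨hsum₁, hsum₂⟩ := Prod.ext_iff.1 hsum
  simp only [Prod.fst_add, Prod.snd_add] at hsum₁ hsum₂
  have hor := abs_le.1 H.abs_hor_le
  have hor' := abs_le.1 H'.abs_hor_le
  have ver := abs_le.1 H.abs_ver_le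
  have ver' := abs_le.1 H'.abs_ver_le
  obtain ⟨hc, vc, -⟩ := H
  obtain ⟨hc', vc', -⟩ := H'
  -- `3 * (c - c')` is a difference of legs, hence at most 8 in both coordinates.
  have near₁ : |c.1 - c'.1| ≤ 2 := abs_le.2 (by omega)
  have near₂ : |c.2 - c'.2| ≤ 2 := abs_le.2 (by omega)
  have hcc : c = c' := by
    by_contra hne
    have := far hne
    have := sq_le_sq' (abs_le.1 near₁).1 (abs_le.1 near₁).2
    have := sq_le_sq' (abs_le.1 near₂).1 (abs_le.1 near₂).2
    unfold sqDist at *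
    linarith
  subst hcc
  exact ⟨rfl, Prod.ext (by omega) (by omega), Prod.ext (by omega) (by omega)⟩

/-! The rectangles `σ, a, τ, b` and `τ, h, _, v` meet in `τ`. A neighbour of `τ` in the second one
continues a side of the first one straight on, or turns back onto it. -/

lemma far_or_hor_eq {σ a b τ : ℤ × ℤ} (H : Corner345 σ a b) (Hτ : Corner345 τ b a)
    (H' : Corner345 τ h v) (hb : h ≠ b → 3 ^ 2 ≤ sqDist h b) : 6 ^ 2 ≤ sqDist σ h ∨ h = b := by
  refine or_iff_not_imp_right.2 fun hne => ?_
  have hfst : h.1 - σ.1 = (a.1 - σ.1) + (h.1 - τ.1) := by rw [Hτ.2.1]; ring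
  have hsnd : h.2 = b.2 := by rw [H'.1, Hτ.1]
  have hfar := hb hne
  rw [sqDist, hsnd, H.2.1, sub_self, hfst] at hfar
  have := six_sq_le_add_sq H.abs_hor H'.abs_hor (by linarith)
  rw [← hfst] at this
  rw [sqDist_comm, sqDist]
  linarith [sq_nonneg (h.2 - σ.2)]

lemma far_or_ver_eq {σ a b τ : ℤ × ℤ} (H : Corner345 σ a b) (Hτ : Corner345 τ b a)
    (H' : Corner345 τ h v) (ha : v ≠ a → 3 ^ 2 ≤ sqDist v a) : 6 ^ 2 ≤ sqDist σ v ∨ v = a := by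
  rw [← sqDist_swap, ← Prod.swap_inj]
  refine H.swap.far_or_hor_eq Hτ.swap H'.swap fun hne => ?_
  rw [sqDist_swap]
  exact ha (mt (congrArg Prod.swap) hne)

end Corner345

namespace AxisStep

variable {p x y : ℤ × ℤ}

lemma fifty_le_of_hor_hor (hx : x.2 = p.2) (hy : y.2 = p.2) (dx : |x.1 - p.1| = 3 ∨ |x.1 - p.1| = 4)
    (dy : |y.1 - p.1| = 3 ∨ |y.1 - p.1| = 4) (hxy : 3 ^ 2 ≤ sqDist x y) :
    50 ≤ sqDist p x + sqDist p y + sqDist x y := by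
  have hdiff : x.1 - y.1 = (x.1 - p.1) + (p.1 - y.1) := by ring
  rw [abs_sub_comm y.1] at dy
  simp only [sqDist, hx, hy, sub_self] at hxy ⊢
  have hfar : 6 ^ 2 ≤ (x.1 - y.1) ^ 2 := by
    rw [hdiff] at hxy ⊢
    exact six_sq_le_add_sq dx dy (by linarith)
  rw [← sq_abs (p.1 - x.1), abs_sub_comm, sq_abs]
  rcases sq_eq_of_abs_eq_three_or_four dx with ex | ex <;>
    rcases sq_eq_of_abs_eq_three_or_four dy with ey | ey <;> linarith

lemma fifty_le_or_legs_of_hor_ver (hx : x.2 = p.2) (hy : y.1 = p.1)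
    (dx : |x.1 - p.1| = 3 ∨ |x.1 - p.1| = 4) (dy : |y.2 - p.2| = 3 ∨ |y.2 - p.2| = 4) :
    50 ≤ sqDist p x + sqDist p y + sqDist x y ∨
      (sqDist p x = 3 ^ 2 ∧ sqDist p y = 3 ^ 2 ∧ sqDist x y = 3 ^ 2 + 3 ^ 2) := by
  have hpx : sqDist p x = (x.1 - p.1) ^ 2 := by simp only [sqDist, hx]; ring
  have hpy : sqDist p y = (y.2 - p.2) ^ 2 := by simp only [sqDist, hy]; ring
  have pythagoras : sqDist x y = sqDist p x + sqDist p y := by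
    simp only [sqDist, hx, hy]; ring
  rw [pythagoras, hpx, hpy]
  rcases sq_eq_of_abs_eq_three_or_four dx with ex | ex <;>
    rcases sq_eq_of_abs_eq_three_or_four dy with ey | ey <;> rw [ex, ey] <;> norm_num

lemma fifty_le_or_legs (hx : AxisStep p x) (hy : AxisStep p y) (hxy : 3 ^ 2 ≤ sqDist x y) :
    50 ≤ sqDist p x + sqDist p y + sqDist x y ∨
      (sqDist p x = 3 ^ 2 ∧ sqDist p y = 3 ^ 2 ∧ sqDist x y = 3 ^ 2 + 3 ^ 2) := by
  rcases hx with ⟨ex, dx⟩ | ⟨ex, dx⟩ <;> rcases hy with ⟨ey, dy⟩ | ⟨ey, dy⟩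
  · exact Or.inl (fifty_le_of_hor_hor ex ey dx dy hxy)
  · exact fifty_le_or_legs_of_hor_ver ex ey dx dy
  · have := fifty_le_or_legs_of_hor_ver ey ex dy dx
    rw [sqDist_comm y x] at this
    exact this.imp (by intro; linarith) fun ⟨h₁, h₂, h₃⟩ => ⟨h₂, h₁, h₃⟩
  · have := fifty_le_of_hor_hor (p := p.swap) (x := x.swap) (y := y.swap) ex ey dx dy
      (by rwa [sqDist_swap])
    simp only [sqDist_swap] at this
    exact Or.inl this

end AxisStep

namespace Is345

variable {f g : Fin 3 → ℤ × ℤ}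

lemma comp_perm (hf : Is345 f) (τ : Equiv.Perm (Fin 3)) : Is345 fun i => f (τ i) := by
  obtain ⟨σ, hσ⟩ := hf
  exact ⟨σ.trans τ.symm, by simpa using hσ⟩

lemma sqSpread_eq_fifty (hf : Is345 f) : sqSpread f = 50 := by
  obtain ⟨σ, hσ⟩ := hf
  rw [sqSpread_eq f (a := σ 0) (b := σ 1) (c := σ 2) (by simp) (by simp) (by simp), hσ.sum_sqDist]

lemma exists_perm_of_sum_eq (hf : Is345 f) (hg : Is345 g)
    (far : ∀ i j, f i ≠ g j → 3 ^ 2 ≤ sqDist (f i) (g j)) (hsum : ∑ i, f i = ∑ i, g i) :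
    ∃ σ : Equiv.Perm (Fin 3), ∀ i, f i = g (σ i) := by
  obtain ⟨σ, hσ⟩ := hf
  obtain ⟨τ, hτ⟩ := hg
  rw [← Equiv.sum_comp σ, ← Equiv.sum_comp τ g, Fin.sum_univ_three, Fin.sum_univ_three] at hsum
  obtain ⟨h₀, h₁, h₂⟩ := hσ.eq_of_sum_eq hτ (far _ _) hsum
  refine ⟨σ.symm.trans τ, fun i => ?_⟩
  obtain ⟨j, rfl⟩ := σ.surjective i
  rw [Equiv.trans_apply, Equiv.symm_apply_apply]
  fin_cases j
  exacts [h₀, h₁, h₂]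

end Is345

/-! ### Combination measures with few support points -/

namespace UC3P

variable {U : UC3P} {Φ : ℝ}

/-- Every support point of the three measures lies in exactly one tuple of `S`. -/
def IsPerfect (S : Set U.Tuple) : Prop := ∀ i (p : U.ι i), ∃! s, s ∈ S ∧ s i = p

lemma n_pos {i : Fin 3} (p : U.ι i) : 0 < U.n :=
  U.card_eq i ▸ Fintype.card_pos_iff.2 ⟨p⟩

lemma cost_eq_sum_norm_sub (s : U.Tuple) : U.cost s =
    (∑ i, ‖U.point i (s i) - U.point (i + 1) (s (i + 1))‖ ^ 2) / 9 := by
  simp only [cost, mean, EuclideanSpace.norm_sq_eq, Fin.sum_univ_two, Fin.sum_univ_three,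
    PiLp.sub_apply, PiLp.add_apply, PiLp.smul_apply, smul_eq_mul, Real.norm_eq_abs, sq_abs,
    Fin.reduceAdd]
  ring

lemma IsPerfect.bijective {S : Set U.Tuple} (hS : IsPerfect S) (i : Fin 3) :
    Function.Bijective fun s : S => s.1 i := by
  refine Function.bijective_iff_existsUnique _ |>.2 fun p => ?_
  obtain ⟨s, ⟨hs, hp⟩, hu⟩ := hS i p
  exact ⟨⟨s, hs⟩, hp, fun s' hs' => Subtype.ext (hu s' ⟨s'.2, hs'⟩)⟩

lemma IsPerfect.eq_of_apply_eq {S : Set U.Tuple} (hS : IsPerfect S) {s s' : U.Tuple} (hs : s ∈ S)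
    (hs' : s' ∈ S) {i : Fin 3} (h : s i = s' i) : s = s' :=
  (hS i (s' i)).unique ⟨hs, h⟩ ⟨hs', rfl⟩

lemma IsPerfect.ncard_eq {S : Set U.Tuple} (hS : IsPerfect S) : S.ncard = U.n := by
  rw [← Nat.card_coe_set_eq, Nat.card_congr (Equiv.ofBijective _ (hS.bijective 0)),
    Nat.card_eq_fintype_card, U.card_eq]

namespace CombinationMeasure

open Classical in
lemma sum_mass (P : U.CombinationMeasure) : ∑ s, P.mass s = U.n * (1 / (U.n : ℝ)) := by
  rw [← Finset.sum_fiberwise univ (fun s : U.Tuple => s 0) P.mass]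
  simp only [P.marginal 0, Finset.sum_const, Finset.card_univ, U.card_eq 0, nsmul_eq_mul]

open Classical in
lemma exists_mass_pos (P : U.CombinationMeasure) (i : Fin 3) (p : U.ι i) :
    ∃ s, 0 < P.mass s ∧ s i = p := by
  have hn : (0 : ℝ) < U.n := Nat.cast_pos.2 (n_pos p)
  by_contra! hzero
  have hsum := P.marginal i p
  rw [Finset.sum_eq_zero fun s hs => ?_] at hsum
  · exact (one_div_pos.2 hn).ne hsum
  · exact (P.mass_nonneg s).antisymm' (not_lt.1 fun hpos => hzero s hpos (Finset.mem_filter.1 hs).2)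

lemma isPerfect_of_ncard_supp_le (P : U.CombinationMeasure) (h : P.supp.ncard ≤ U.n) :
    IsPerfect {s | 0 < P.mass s} := by
  intro i
  let S : Set U.Tuple := {s | 0 < P.mass s}
  have hsurj : Function.Surjective fun s : S => s.1 i := fun p => by
    obtain ⟨s, hs, hp⟩ := P.exists_mass_pos i p
    exact ⟨⟨s, hs⟩, hp⟩
  have hcard : Nat.card S ≤ Nat.card (U.ι i) := by
    rwa [Nat.card_eq_fintype_card (α := U.ι i), U.card_eq, Nat.card_coe_set_eq,
      ← P.mean_injOn.ncard_image]
  intro p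
  obtain ⟨s, hs, hu⟩ := (hsurj.bijective_of_nat_card_le hcard).existsUnique p
  exact ⟨s, ⟨s.2, hs⟩, fun s' ⟨hs', hp⟩ => congrArg Subtype.val (hu ⟨s', hs'⟩ hp)⟩

lemma cost_eq_of_totalCost_le (P : U.CombinationMeasure) (hΦ : ∀ s, Φ ≤ U.cost s)
    (h : P.totalCost ≤ Φ) {s : U.Tuple} (hs : 0 < P.mass s) : U.cost s = Φ := by
  have hmass : ∑ s, P.mass s = 1 := by
    rw [P.sum_mass, mul_one_div_cancel (Nat.cast_ne_zero.2 (n_pos (s 0)).ne')]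
  have hnonneg : ∀ s ∈ univ, 0 ≤ (U.cost s - Φ) * P.mass s := fun s _ =>
    mul_nonneg (sub_nonneg.2 (hΦ s)) (P.mass_nonneg s)
  have hexcess : ∑ s, (U.cost s - Φ) * P.mass s = 0 := by
    refine le_antisymm ?_ (Finset.sum_nonneg hnonneg)
    simp only [sub_mul, Finset.sum_sub_distrib, ← Finset.mul_sum, hmass, mul_one]
    exact sub_nonpos.2 h
  have hzero := (Finset.sum_eq_zero_iff_of_nonneg hnonneg).1 hexcess s (Finset.mem_univ s)
  exact sub_eq_zero.1 ((mul_eq_zero.1 hzero).resolve_right hs.ne')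

end CombinationMeasure

open Classical in
/-- The combination measure with mass `1 / n` on each tuple of a perfect system. -/
noncomputable def IsPerfect.measure {S : Set U.Tuple} (hS : IsPerfect S)
    (hmean : S.InjOn U.mean) : U.CombinationMeasure where
  mass s := if s ∈ S then 1 / (U.n : ℝ) else 0
  mass_nonneg s := by split_ifs <;> positivity
  marginal i p := by
    obtain ⟨s, ⟨hs, hp⟩, hu⟩ := hS i p
    rw [Finset.sum_eq_single_of_mem s (by simpa using hp), if_pos hs]
    intro s' hs' hne
    exact if_neg fun h => hne (hu s' ⟨h, (Finset.mem_filter.1 hs').2⟩)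
  mean_injOn := hmean.mono fun s hs => by
    by_contra h
    simp [h] at hs

lemma IsPerfect.mem_of_measure_mass_ne_zero {S : Set U.Tuple} (hS : IsPerfect S)
    (hmean : S.InjOn U.mean) {s : U.Tuple} (hs : (hS.measure hmean).mass s ≠ 0) : s ∈ S := by
  by_contra h
  exact hs (if_neg h)

lemma IsPerfect.isYes {S : Set U.Tuple} (hS : IsPerfect S) (hmean : S.InjOn U.mean) (hΦ : 0 ≤ Φ)
    (hcost : ∀ s ∈ S, U.cost s ≤ Φ) : U.IsYes U.n Φ := by
  refine ⟨hS.measure hmean, ?_, ?_⟩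
  · calc (hS.measure hmean).supp.ncard ≤ (U.mean '' S).ncard := Set.ncard_le_ncard <|
          Set.image_mono fun s hs => hS.mem_of_measure_mass_ne_zero hmean (ne_of_gt hs)
      _ ≤ S.ncard := Set.ncard_image_le
      _ = U.n := hS.ncard_eq
  · have hle : ∀ s, U.cost s * (hS.measure hmean).mass s ≤ Φ * (hS.measure hmean).mass s := by
      intro s
      by_cases hs : (hS.measure hmean).mass s = 0
      · rw [hs, mul_zero, mul_zero]
      · exact mul_le_mul_of_nonneg_right (hcost s (hS.mem_of_measure_mass_ne_zero hmean hs))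
          ((hS.measure hmean).mass_nonneg s)
    calc (hS.measure hmean).totalCost ≤ ∑ s, Φ * (hS.measure hmean).mass s :=
          Finset.sum_le_sum fun s _ => hle s
      _ = Φ * (U.n / U.n) := by
          rw [← Finset.mul_sum, CombinationMeasure.sum_mass, mul_one_div]
      _ ≤ Φ := mul_le_of_le_one_right hΦ (div_self_le_one _)

theorem isYes_n_iff_exists_isPerfect (hΦ : 0 ≤ Φ) (hcost : ∀ s, Φ ≤ U.cost s) :
    U.IsYes U.n Φ ↔
      ∃ S : Set U.Tuple, IsPerfect S ∧ S.InjOn U.mean ∧ ∀ s ∈ S, U.cost s = Φ := by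
  constructor
  · rintro ⟨P, hsupp, htotal⟩
    exact ⟨_, P.isPerfect_of_ncard_supp_le hsupp, P.mean_injOn,
      fun _ hs => P.cost_eq_of_totalCost_le hcost htotal hs⟩
  · rintro ⟨S, hS, hmean, hS_cost⟩
    exact hS.isYes hmean hΦ fun s hs => (hS_cost s hs).le

end UC3P

/-! ### Matchings -/

lemma tripleElement_injective {X Y Z : Type*} (t : X × Y × Z) :
    Function.Injective (tripleElement t) := by
  intro i j h
  fin_cases i <;> fin_cases j <;> simp [tripleElement] at h ⊢

section TrianglePaths

variable {X Y Z : Type*} [Fintype X] [Fintype Y] [Fintype Z] {D : P3DM X Y Z}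

namespace P3DM

/-- Every element occurs in exactly one of the triples of `M`. -/
def IsMatching (M : Set D.T) : Prop := ∀ e, ∃! t, t ∈ M ∧ OccursIn e t.1

lemma isYes_iff_exists_isMatching : D.IsYes ↔ ∃ M : Set D.T, IsMatching M := by
  constructor
  · rintro ⟨T', hsub, hT'⟩
    refine ⟨{t | t.1 ∈ T'}, fun e => ?_⟩
    obtain ⟨t, ⟨ht, he⟩, hu⟩ := hT' e
    exact ⟨⟨t, hsub ht⟩, ⟨ht, he⟩, fun t' ht' => Subtype.ext (hu t'.1 ht')⟩
  · rintro ⟨M, hM⟩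
    classical
    refine ⟨{t : D.T | t ∈ M}.toFinset.map (Function.Embedding.subtype _), ?_, fun e => ?_⟩
    · intro t ht
      obtain ⟨t, -, rfl⟩ := Finset.mem_map.1 ht
      exact t.2
    · obtain ⟨t, ⟨ht, he⟩, hu⟩ := hM e
      refine ⟨t, ⟨Finset.mem_map.2 ⟨t, by simpa using ht, rfl⟩, he⟩, ?_⟩
      rintro _ ⟨mem, he'⟩
      obtain ⟨t', ht', rfl⟩ := Finset.mem_map.1 mem
      exact congrArg Subtype.val (hu t' ⟨by simpa using ht', he'⟩)

namespace IsMatching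

variable {M : Set D.T}

lemma existsUnique_edge (hM : IsMatching M) (e : Element X Y Z) :
    ∃! π : D.Edge, π.1 ∈ M ∧ π.element = e := by
  obtain ⟨t, ⟨ht, i, hi⟩, hu⟩ := hM e
  refine ⟨(t, i), ⟨ht, hi⟩, ?_⟩
  rintro ⟨t', i'⟩ ⟨ht', hi'⟩
  obtain rfl : t' = t := hu t' ⟨ht', i', hi'⟩
  exact congrArg (Prod.mk t') (tripleElement_injective t'.1 (hi'.trans hi.symm))

/-- The edge that joins an element to the triple of the matching in which it occurs. -/
noncomputable def edge (hM : IsMatching M) (e : Element X Y Z) : D.Edge :=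
  (hM.existsUnique_edge e).choose

lemma edge_mem (hM : IsMatching M) (e : Element X Y Z) : (hM.edge e).1 ∈ M :=
  (hM.existsUnique_edge e).choose_spec.1.1

lemma element_edge (hM : IsMatching M) (e : Element X Y Z) : (hM.edge e).element = e :=
  (hM.existsUnique_edge e).choose_spec.1.2

lemma edge_element (hM : IsMatching M) {π : D.Edge} (hπ : π.1 ∈ M) : hM.edge π.element = π :=
  (hM.existsUnique_edge π.element).unique ⟨hM.edge_mem _, hM.element_edge _⟩ ⟨hπ, rfl⟩

end IsMatching

end P3DM

/-! ### The region of an element -/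

namespace TrianglePaths

variable (G : TrianglePaths D)

/-- The element at which the path through a vertex starts; an element point is its own home. The
vertices with home `e` make up the region of `e`. -/
def home : G.Vertex → Element X Y Z
  | Sum.inl e => e
  | Sum.inr v => v.1.element

/-- The vertex is the start or the finish of a pair of triangles. -/
def IsJoint : G.Vertex → Prop
  | Sum.inl _ => True
  | Sum.inr v => v.2.2 = 2

lemma start_first (π : D.Edge) : G.start π (G.first π) = Sum.inl π.element := if_pos rfl

lemma start_succ {π : D.Edge} {k k' : Fin (G.len π)} (h : k'.1 = k.1 + 1) :
    G.start π k' = G.finish π k := by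
  rw [start, if_neg (by omega)]
  congr 1
  exact Fin.ext (by simp [h])

lemma home_start (π : D.Edge) (k : Fin (G.len π)) : G.home (G.start π k) = π.element := by
  unfold start
  split_ifs <;> rfl

lemma isJoint_start (π : D.Edge) (k : Fin (G.len π)) : G.IsJoint (G.start π k) := by
  unfold start
  split_ifs
  exacts [trivial, rfl]

lemma home_corner (π : D.Edge) (k : Fin (G.len π)) (j : Fin 4) :
    G.home (G.corner π k j) = π.element := by
  fin_cases j
  · exact G.home_start π k
  all_goals rfl

variable {G}

lemma IsDuplicate.home_eq {u v : G.Vertex} (h : G.IsDuplicate u v) : G.home u = G.home v := by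
  obtain ⟨π, π', k, k', hu, hv, h⟩ := h
  have hu' : G.home u = π.element := by rcases hu with rfl | rfl <;> rfl
  have hv' : G.home v = π'.element := by rcases hv with rfl | rfl <;> rfl
  rw [hu', hv']
  rcases h with h | h | h
  · rw [← G.home_start π k, h, G.home_start]
  · rw [← G.home_start π' k', ← h]; rfl
  · rw [← G.home_start π k, ← h]; rfl

lemma IsDuplicate.not_isJoint {u v : G.Vertex} (h : G.IsDuplicate u v) : ¬ G.IsJoint u := by
  obtain ⟨π, -, k, -, rfl | rfl, -⟩ := h <;> simp [IsJoint, hor, ver]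

lemma IsJoint.eq_start_or_finish {π : D.Edge} {k : Fin (G.len π)} {j : Fin 4}
    (h : G.IsJoint (G.corner π k j)) :
    G.corner π k j = G.start π k ∨ G.corner π k j = G.finish π k := by
  fin_cases j
  · exact Or.inl rfl
  · simp [IsJoint, corner, hor] at h
  · simp [IsJoint, corner, ver] at h
  · exact Or.inr rfl

lemma tripleVertex_left_injective {t t' : D.T} {i i' : Fin 3}
    (h : G.tripleVertex t i = G.tripleVertex t' i') : t = t' := by
  simp only [tripleVertex, finish, Sum.inr.injEq, Sigma.mk.injEq, Prod.mk.injEq] at h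
  exact h.1.1

end TrianglePaths

namespace TrianglePathGraph

variable (G : TrianglePathGraph D)

lemma home_eq_of_loc_eq {u v : G.Vertex} (h : G.loc u = G.loc v) : G.home u = G.home v := by
  by_cases huv : u = v
  · rw [huv]
  · exact (G.duplicate u v huv h).home_eq

lemma eq_of_loc_eq_of_isJoint {u v : G.Vertex} (hu : G.IsJoint u) (h : G.loc u = G.loc v) :
    u = v := by
  by_contra huv
  exact (G.duplicate u v huv h).not_isJoint hu

lemma part_finish_eq_start (π : D.Edge) (k : Fin (G.len π)) :
    G.part (G.finish π k) = G.part (G.start π k) := by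
  obtain ⟨h₁, h₂, h₃⟩ := G.feasible_start π k
  obtain ⟨-, h₄, h₅⟩ := G.feasible_finish π k
  omega

lemma part_start (π : D.Edge) (k : Fin (G.len π)) :
    G.part (G.start π k) = G.part (Sum.inl π.element) := by
  obtain ⟨k, hk⟩ := k
  induction k with
  | zero => exact congrArg G.part (G.start_first π)
  | succ k ih => rw [G.start_succ (k := ⟨k, by omega⟩) rfl, part_finish_eq_start, ih]

lemma part_finish (π : D.Edge) (k : Fin (G.len π)) :
    G.part (G.finish π k) = G.part (Sum.inl π.element) := by
  rw [part_finish_eq_start, part_start]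

lemma part_tripleVertex (t : D.T) (i : Fin 3) :
    G.part (G.tripleVertex t i) = G.part (Sum.inl (tripleElement t.1 i)) :=
  G.part_finish (t, i) _

lemma isJoint_iff (v : G.Vertex) : G.IsJoint v ↔ G.part v = G.part (Sum.inl (G.home v)) := by
  rcases v with e | ⟨π, k, j⟩
  · exact iff_of_true trivial rfl
  · obtain ⟨-, hor_ne, ver_ne⟩ := G.feasible_finish π k
    rw [part_finish] at hor_ne ver_ne
    fin_cases j
    · exact iff_of_false (by simp [TrianglePaths.IsJoint]) hor_ne
    · exact iff_of_false (by simp [TrianglePaths.IsJoint]) ver_ne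
    · exact iff_of_true rfl (G.part_finish π k)

lemma corner_eq_hor_or_ver {π : D.Edge} {k : Fin (G.len π)} {j : Fin 4}
    (h : G.part (G.corner π k j) ≠ G.part (Sum.inl π.element)) :
    G.corner π k j = G.hor π k ∨ G.corner π k j = G.ver π k := by
  fin_cases j
  · exact absurd (G.part_start π k) h
  · exact Or.inl rfl
  · exact Or.inr rfl
  · exact absurd (G.part_finish π k) h

lemma home_of_onPath {π : D.Edge} {u : G.Vertex} (h : G.OnPath π u) : G.home u = π.element := by
  obtain ⟨k, j, h⟩ := h
  rw [G.home_eq_of_loc_eq h, G.home_corner]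

lemma home_of_onFirstPair {e : Element X Y Z} {u : G.Vertex} (h : G.OnFirstPair e u) :
    G.home u = e := by
  obtain ⟨π, rfl, j, rfl⟩ := h
  exact G.home_corner _ _ _

open Classical in
lemma card_part_home (c : Fin 3) (e : Element X Y Z) :
    #{v : G.Vertex | G.part v = c ∧ G.home v = e} =
      (if G.part (Sum.inl e) = c then 1 else 0) + ∑ π : D.Edge with π.element = e, G.len π := by
  have pair (π : D.Edge) (k : Fin (G.len π)) :
      (∑ j : Fin 3, if G.part (Sum.inr ⟨π, k, j⟩) = c ∧ π.element = e then 1 else 0) =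
        if π.element = e then 1 else 0 := by
    obtain ⟨j, hj, hu⟩ := (G.part_pair_bijective π k).existsUnique c
    rw [Fintype.sum_eq_single j fun i hi => if_neg fun h => hi (hu i h.1)]
    exact if_congr (and_iff_right hj) rfl rfl
  rw [Finset.card_filter, Fintype.sum_sum_type, Fintype.sum_sigma, Finset.sum_filter]
  congr 1
  · rw [Fintype.sum_eq_single e fun e' he => if_neg fun h => he h.2]
    exact if_congr (and_iff_left rfl) rfl rfl
  · refine Finset.sum_congr rfl fun π _ => ?_
    rw [Fintype.sum_prod_type]
    refine (Finset.sum_congr rfl fun k _ => pair π k).trans ?_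
    split_ifs <;> simp

/-! ### Distances in the region of an element -/

variable {G}

lemma axisStep_of_same_pair {π : D.Edge} {k : Fin (G.len π)} {u v : G.Vertex}
    (hu : u = G.start π k ∨ u = G.finish π k) (hv : v = G.hor π k ∨ v = G.ver π k) :
    AxisStep (G.loc u) (G.loc v) := by
  rcases hu with rfl | rfl <;> rcases hv with rfl | rfl
  exacts [(G.pair_start π k).axisStep_hor, (G.pair_start π k).axisStep_ver,
    (G.pair_finish π k).axisStep_ver, (G.pair_finish π k).axisStep_hor]

lemma far_or_axisStep_start {π : D.Edge} {k k' : Fin (G.len π)} (h : k'.1 = k.1 + 1)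
    {v : G.Vertex} (hv : v = G.hor π k' ∨ v = G.ver π k') :
    6 ^ 2 ≤ G.sqd (G.start π k) v ∨ AxisStep (G.loc (G.start π k)) (G.loc v) := by
  have hk := G.pair_start π k
  have hk' := G.pair_start π k'
  rw [G.start_succ h] at hk'
  rcases hv with rfl | rfl
  · refine (hk.far_or_hor_eq (G.pair_finish π k) hk' (G.three_le_dist _ _)).imp_right fun e => ?_
    rw [e]
    exact hk.axisStep_ver
  · refine (hk.far_or_ver_eq (G.pair_finish π k) hk' (G.three_le_dist _ _)).imp_right fun e => ?_
    rw [e]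
    exact hk.axisStep_hor

lemma far_or_axisStep_finish {π : D.Edge} {k k' : Fin (G.len π)} (h : k'.1 = k.1 + 1)
    {v : G.Vertex} (hv : v = G.hor π k ∨ v = G.ver π k) :
    6 ^ 2 ≤ G.sqd (G.finish π k') v ∨ AxisStep (G.loc (G.finish π k')) (G.loc v) := by
  have hk := G.pair_finish π k
  have hk' := G.pair_finish π k'
  rw [← G.start_succ h] at hk
  rcases hv with rfl | rfl
  · refine (hk'.far_or_ver_eq (G.pair_start π k') hk (G.three_le_dist _ _)).imp_right fun e => ?_
    rw [e]
    exact hk'.axisStep_hor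
  · refine (hk'.far_or_hor_eq (G.pair_start π k') hk (G.three_le_dist _ _)).imp_right fun e => ?_
    rw [e]
    exact hk'.axisStep_ver

lemma far_or_axisStep_of_near_pairs {π : D.Edge} {k k' : Fin (G.len π)} (h : k.1 ≤ k'.1 + 1)
    (h' : k'.1 ≤ k.1 + 1) {u v : G.Vertex} (hu : u = G.start π k ∨ u = G.finish π k)
    (hv : v = G.hor π k' ∨ v = G.ver π k') :
    6 ^ 2 ≤ G.sqd u v ∨ AxisStep (G.loc u) (G.loc v) := by
  obtain same | next | prev : k = k' ∨ k'.1 = k.1 + 1 ∨ k.1 = k'.1 + 1 := by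
    rw [Fin.ext_iff]; omega
  · subst same
    exact Or.inr (axisStep_of_same_pair hu hv)
  · rcases hu with rfl | rfl
    · exact far_or_axisStep_start next hv
    · exact Or.inr (axisStep_of_same_pair (Or.inl (G.start_succ next).symm) hv)
  · rcases hu with rfl | rfl
    · exact Or.inr (axisStep_of_same_pair (Or.inr (G.start_succ prev)) hv)
    · exact far_or_axisStep_finish prev hv

lemma far_or_axisStep_of_onPath {π : D.Edge} {u v : G.Vertex} (hu : G.OnPath π u)
    (hv : G.OnPath π v) (hjoint : G.IsJoint u) (huv : G.part u ≠ G.part v) :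
    6 ^ 2 ≤ G.sqd u v ∨ AxisStep (G.loc u) (G.loc v) := by
  rcases G.path_spacing π u v hu hv with ⟨k, k', hk, hk', ⟨j, hj⟩, ⟨j', hj'⟩⟩ | far
  · obtain rfl := G.eq_of_loc_eq_of_isJoint hjoint hj
    rw [(G.isJoint_iff _).1 hjoint, G.home_of_onPath hu, G.part_eq _ _ hj'] at huv
    have := far_or_axisStep_of_near_pairs hk hk' hjoint.eq_start_or_finish
      (G.corner_eq_hor_or_ver huv.symm)
    rwa [TrianglePaths.sqd, ← hj'] at this
  · exact Or.inl far

lemma axisStep_of_onFirstPair {e : Element X Y Z} {v : G.Vertex} (h : G.OnFirstPair e v)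
    (hv : G.part (Sum.inl e) ≠ G.part v) : AxisStep (G.loc (Sum.inl e)) (G.loc v) := by
  obtain ⟨π, rfl, j, rfl⟩ := h
  exact axisStep_of_same_pair (Or.inl (G.start_first π).symm) (G.corner_eq_hor_or_ver hv.symm)

/-! ### The cost of a tuple -/

/-- The vertices of a tuple of support points. -/
def vert (s : G.toUC3P.Tuple) (c : Fin 3) : G.Vertex := (s c).1

/-- The integer coordinates of the vertices of a tuple. -/
def coords (s : G.toUC3P.Tuple) (c : Fin 3) : ℤ × ℤ := G.loc (vert s c)

lemma part_vert (s : G.toUC3P.Tuple) (c : Fin 3) : G.part (vert s c) = c := (s c).2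

lemma range_vert (s : G.toUC3P.Tuple) :
    Set.range (vert s) = {vert s 0, vert s 1, vert s 2} := by
  ext v
  simp [Fin.exists_fin_succ, eq_comm]

lemma part_vert_ne (s : G.toUC3P.Tuple) {c c' : Fin 3} (h : c ≠ c') :
    G.part (vert s c) ≠ G.part (vert s c') := by
  rwa [part_vert, part_vert]

lemma feasible_vert (s : G.toUC3P.Tuple) : G.Feasible (vert s 0) (vert s 1) (vert s 2) :=
  ⟨part_vert_ne s (by decide), part_vert_ne s (by decide), part_vert_ne s (by decide)⟩

lemma isJoint_vert {s : G.toUC3P.Tuple} {e : Element X Y Z}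
    (h : G.home (vert s (G.part (Sum.inl e))) = e) : G.IsJoint (vert s (G.part (Sum.inl e))) := by
  rw [G.isJoint_iff, part_vert, h]

lemma cost_eq_sqSpread (s : G.toUC3P.Tuple) : G.toUC3P.cost s = (sqSpread (coords s) : ℝ) / 9 := by
  rw [UC3P.cost_eq_sum_norm_sub, sqSpread, Int.cast_sum]
  exact congrArg (· / 9) (Finset.sum_congr rfl fun i _ => norm_sub_sq_eq_sqDist _ _)

lemma cost_eq_fifty_div_nine_iff (s : G.toUC3P.Tuple) :
    G.toUC3P.cost s = 50 / 9 ↔ sqSpread (coords s) = 50 := by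
  rw [cost_eq_sqSpread, div_left_inj' (by norm_num)]
  norm_cast

/-- The vertices of the tuple are the vertices of the triple triangle of `t`. -/
def IsTripleTuple (s : G.toUC3P.Tuple) (t : D.T) : Prop :=
  Set.range (vert s) = Set.range (G.tripleVertex t)

lemma IsTripleTuple.coords_is345 {s : G.toUC3P.Tuple} {t : D.T} (h : IsTripleTuple s t) :
    Is345 (coords s) := by
  choose σ hσ using fun c => (h ▸ Set.mem_range_self c : vert s c ∈ Set.range (G.tripleVertex t))
  have hinj : Function.Injective σ := fun c c' hcc => by
    rw [← part_vert s c, ← hσ, hcc, hσ, part_vert]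
  have hbij := Finite.injective_iff_bijective.1 hinj
  have htri := (G.triple_triangle t).comp_perm (Equiv.ofBijective σ hbij)
  simp only [Equiv.ofBijective_apply, hσ] at htri
  exact htri

lemma spacing_tuple (s : G.toUC3P.Tuple) :
    (∃ π, ∀ c, G.OnPath π (vert s c)) ∨
    (∃ e, (∃ c, vert s c = Sum.inl e) ∧ ∀ c, G.OnFirstPair e (vert s c)) ∨
    (∃ t, IsTripleTuple s t) ∨ ∃ c c', c ≠ c' ∧ 6 ^ 2 ≤ sqDist (coords s c) (coords s c') := by
  have h := G.spacing _ _ _ (feasible_vert s)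
  rw [← range_vert] at h
  rcases h with ⟨π, h₀, h₁, h₂⟩ | ⟨e, he, h⟩ | h | h | h | h
  · exact Or.inl ⟨π, fun c => by fin_cases c <;> assumption⟩
  · exact Or.inr (Or.inl ⟨e, he, fun c => h _ (Set.mem_range_self c)⟩)
  · exact Or.inr (Or.inr (Or.inl h))
  · exact Or.inr (Or.inr (Or.inr ⟨0, 1, by decide, h⟩))
  · exact Or.inr (Or.inr (Or.inr ⟨0, 2, by decide, h⟩))
  · exact Or.inr (Or.inr (Or.inr ⟨1, 2, by decide, h⟩))

lemma fifty_le_sqSpread_of_axisStep {s : G.toUC3P.Tuple} {c : Fin 3}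
    (h : ∀ c' ≠ c, AxisStep (coords s c) (coords s c')) : 50 ≤ sqSpread (coords s) := by
  obtain ⟨a, b, ha, hb, hab⟩ : ∃ a b : Fin 3, a ≠ c ∧ b ≠ c ∧ a ≠ b := by
    clear h
    decide +revert
  have far : 3 ^ 2 ≤ sqDist (coords s a) (coords s b) :=
    G.three_le_dist _ _ fun e => part_vert_ne s hab (G.part_eq _ _ e)
  rw [sqSpread_eq _ ha.symm hb.symm hab]
  refine ((h a ha).fifty_le_or_legs (h b hb) far).resolve_right fun ⟨h₁, h₂, h₃⟩ => ?_
  exact G.not_feasible_of_legs _ _ _ h₁ h₂ h₃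
    ⟨part_vert_ne s ha.symm, part_vert_ne s hb.symm, part_vert_ne s hab⟩

lemma fifty_le_sqSpread_of_onPath {s : G.toUC3P.Tuple} {π : D.Edge}
    (h : ∀ c, G.OnPath π (vert s c)) : 50 ≤ sqSpread (coords s) := by
  by_cases far : ∃ c c', c ≠ c' ∧ 6 ^ 2 ≤ sqDist (coords s c) (coords s c')
  · obtain ⟨c, c', hne, far⟩ := far
    exact (fifty_lt_sqSpread_of_far hne far).le
  · refine fifty_le_sqSpread_of_axisStep (c := G.part (Sum.inl π.element)) fun c' hne => ?_
    have := far_or_axisStep_of_onPath (h _) (h c') (isJoint_vert (G.home_of_onPath (h _)))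
      (part_vert_ne s hne.symm)
    exact this.resolve_left fun hfar => far ⟨_, c', hne.symm, hfar⟩

lemma fifty_le_sqSpread_of_onFirstPair {s : G.toUC3P.Tuple} {e : Element X Y Z} {c : Fin 3}
    (he : vert s c = Sum.inl e) (h : ∀ c, G.OnFirstPair e (vert s c)) :
    50 ≤ sqSpread (coords s) := by
  refine fifty_le_sqSpread_of_axisStep (c := c) fun c' hne => ?_
  rw [coords, he]
  exact axisStep_of_onFirstPair (h c') (he ▸ part_vert_ne s hne.symm)

lemma fifty_le_sqSpread (s : G.toUC3P.Tuple) : 50 ≤ sqSpread (coords s) := by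
  rcases spacing_tuple s with ⟨π, h⟩ | ⟨e, ⟨c, he⟩, h⟩ | ⟨t, h⟩ | ⟨c, c', hne, far⟩
  · exact fifty_le_sqSpread_of_onPath h
  · exact fifty_le_sqSpread_of_onFirstPair he h
  · exact h.coords_is345.sqSpread_eq_fifty.ge
  · exact (fifty_lt_sqSpread_of_far hne far).le

lemma fifty_div_nine_le_cost (s : G.toUC3P.Tuple) : 50 / 9 ≤ G.toUC3P.cost s := by
  rw [cost_eq_sqSpread]
  gcongr
  exact_mod_cast fifty_le_sqSpread s

lemma home_eq_or_isTripleTuple {s : G.toUC3P.Tuple} (h : G.toUC3P.cost s = 50 / 9) :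
    (∀ c c', G.home (vert s c) = G.home (vert s c')) ∨ ∃ t, IsTripleTuple s t := by
  rw [cost_eq_fifty_div_nine_iff] at h
  rcases spacing_tuple s with ⟨π, hs⟩ | ⟨e, -, hs⟩ | hs | ⟨c, c', hne, far⟩
  · exact Or.inl fun c c' => (G.home_of_onPath (hs c)).trans (G.home_of_onPath (hs c')).symm
  · exact Or.inl fun c c' =>
      (G.home_of_onFirstPair (hs c)).trans (G.home_of_onFirstPair (hs c')).symm
  · exact Or.inr hs
  · exact absurd h (fifty_lt_sqSpread_of_far hne far).ne'

/-! ### From a perfect system of tuples to a matching -/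

lemma IsTripleTuple.part_home_vert {s : G.toUC3P.Tuple} {t : D.T} (h : IsTripleTuple s t)
    (c : Fin 3) : G.part (Sum.inl (G.home (vert s c))) = c := by
  obtain ⟨i, hi⟩ : vert s c ∈ Set.range (G.tripleVertex t) := h ▸ Set.mem_range_self c
  have hpart := G.part_tripleVertex t i
  rw [hi, part_vert] at hpart
  rw [← hi]
  exact hpart.symm

lemma IsTripleTuple.occursIn_iff {s : G.toUC3P.Tuple} {t : D.T} (h : IsTripleTuple s t)
    {e : Element X Y Z} : OccursIn e t.1 ↔ G.home (vert s (G.part (Sum.inl e))) = e := by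
  constructor
  · rintro ⟨i, rfl⟩
    obtain ⟨c, hc⟩ : G.tripleVertex t i ∈ Set.range (vert s) := h ▸ Set.mem_range_self i
    have hpart := G.part_tripleVertex t i
    rw [← hc, part_vert] at hpart
    rw [← hpart, hc]
    rfl
  · intro he
    obtain ⟨i, hi⟩ : vert s (G.part (Sum.inl e)) ∈ Set.range (G.tripleVertex t) :=
      h ▸ Set.mem_range_self _
    exact ⟨i, by rw [← he, ← hi]; rfl⟩

lemma home_vert_part {s : G.toUC3P.Tuple} (hs : G.toUC3P.cost s = 50 / 9) {c : Fin 3}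
    {e : Element X Y Z} (h : G.home (vert s c) = e) :
    G.home (vert s (G.part (Sum.inl e))) = e := by
  rcases home_eq_or_isTripleTuple hs with hconst | ⟨t, ht⟩
  · rw [hconst _ c, h]
  · rw [← h, ht.part_home_vert]

/-- The tuple leaves the region of `e`: its vertex in the set of `e` has home `e`, and its vertex in
the next set does not. For tuples of cost `50 / 9` it does not matter which other set is taken. -/
def Leaves (s : G.toUC3P.Tuple) (e : Element X Y Z) : Prop :=
  G.home (vert s (G.part (Sum.inl e))) = e ∧ G.home (vert s (G.part (Sum.inl e) + 1)) ≠ e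

lemma leaves_iff_exists_isTripleTuple {s : G.toUC3P.Tuple} (hs : G.toUC3P.cost s = 50 / 9)
    (e : Element X Y Z) : Leaves s e ↔ ∃ t, IsTripleTuple s t ∧ OccursIn e t.1 := by
  constructor
  · rintro ⟨he, hne⟩
    obtain ⟨t, ht⟩ := (home_eq_or_isTripleTuple hs).resolve_left fun h => hne ((h _ _).trans he)
    exact ⟨t, ht, ht.occursIn_iff.2 he⟩
  · rintro ⟨t, ht, he⟩
    refine ⟨ht.occursIn_iff.1 he, fun h => ?_⟩
    have hpart := ht.part_home_vert (G.part (Sum.inl e) + 1)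
    rw [h] at hpart
    exact absurd hpart (by simp)

open Classical in
lemma ncard_home_vert {S : Set G.toUC3P.Tuple} (hS : UC3P.IsPerfect S) (c : Fin 3)
    (e : Element X Y Z) : {s | s ∈ S ∧ G.home (vert s c) = e}.ncard =
      (if G.part (Sum.inl e) = c then 1 else 0) + ∑ π : D.Edge with π.element = e, G.len π := by
  have hinj : Set.InjOn (fun s => vert s c) {s | s ∈ S ∧ G.home (vert s c) = e} :=
    fun s hs s' hs' h => hS.eq_of_apply_eq hs.1 hs'.1 (Subtype.ext h)
  rw [← G.card_part_home, ← hinj.ncard_image, ← Set.ncard_coe_finset]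
  congr 1
  ext v
  simp only [Set.mem_image, Set.mem_ofPred_eq, Finset.coe_filter, Finset.mem_univ, true_and]
  constructor
  · rintro ⟨s, ⟨-, he⟩, rfl⟩
    exact ⟨part_vert s c, he⟩
  · rintro ⟨hv, he⟩
    obtain ⟨s, ⟨hs, hsv⟩, -⟩ := hS c ⟨v, hv⟩
    obtain rfl : vert s c = v := congrArg Subtype.val hsv
    exact ⟨s, ⟨hs, he⟩, rfl⟩

lemma existsUnique_leaves {S : Set G.toUC3P.Tuple} (hS : UC3P.IsPerfect S)
    (hcost : ∀ s ∈ S, G.toUC3P.cost s = 50 / 9) (e : Element X Y Z) :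
    ∃! s, s ∈ S ∧ Leaves s e := by
  let c := G.part (Sum.inl e)
  let A : Set G.toUC3P.Tuple := {s | s ∈ S ∧ G.home (vert s c) = e}
  let B : Set G.toUC3P.Tuple := {s | s ∈ S ∧ G.home (vert s (c + 1)) = e}
  have hBA : B ⊆ A := fun s hs => ⟨hs.1, home_vert_part (hcost s hs.1) hs.2⟩
  have hA := ncard_home_vert hS c e
  have hB := ncard_home_vert hS (c + 1) e
  rw [if_pos rfl] at hA
  rw [if_neg (by simp [c])] at hB
  have hAB : (A \ B).ncard = 1 := by
    rw [Set.ncard_sdiff hBA, hA, hB]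
    omega
  obtain ⟨s, hs⟩ := Set.ncard_eq_one.1 hAB
  have mem_iff (s') : s' ∈ A \ B ↔ s' ∈ S ∧ Leaves s' e := by
    simp only [A, B, c, Leaves, Set.mem_sdiff, Set.mem_ofPred_eq]
    tauto
  simp only [← mem_iff, hs, Set.mem_singleton_iff]
  exact ⟨s, rfl, fun _ h => h⟩

theorem isMatching_of_isPerfect {S : Set G.toUC3P.Tuple} (hS : UC3P.IsPerfect S)
    (hcost : ∀ s ∈ S, G.toUC3P.cost s = 50 / 9) :
    P3DM.IsMatching {t : D.T | ∃ s ∈ S, IsTripleTuple s t} := by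
  intro e
  obtain ⟨s, ⟨hs, hleaves⟩, hu⟩ := existsUnique_leaves hS hcost e
  obtain ⟨t, ht, he⟩ := (leaves_iff_exists_isTripleTuple (hcost s hs) e).1 hleaves
  refine ⟨t, ⟨⟨s, hs, ht⟩, he⟩, ?_⟩
  rintro t' ⟨⟨s', hs', ht'⟩, he'⟩
  obtain rfl : s' = s :=
    hu s' ⟨hs', (leaves_iff_exists_isTripleTuple (hcost s' hs') e).2 ⟨t', ht', he'⟩⟩
  obtain ⟨i, hi⟩ : G.tripleVertex t' 0 ∈ Set.range (G.tripleVertex t) :=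
    ht.symm.trans ht' ▸ Set.mem_range_self 0
  exact TrianglePaths.tripleVertex_left_injective hi.symm

/-! ### Tuples of triangles with equal means -/

lemma sum_coords_eq_of_mean_eq {s s' : G.toUC3P.Tuple} (h : G.toUC3P.mean s = G.toUC3P.mean s') :
    ∑ c, coords s c = ∑ c, coords s' c := by
  have sum_coords (s : G.toUC3P.Tuple) :
      3 * G.toUC3P.mean s 0 = ((∑ c, coords s c).1 : ℤ) ∧
      3 * G.toUC3P.mean s 1 = ((∑ c, coords s c).2 : ℤ) := by
    simp only [UC3P.mean, ← Finset.smul_sum, PiLp.smul_apply, WithLp.ofLp_sum, Finset.sum_apply,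
      Prod.fst_sum, Prod.snd_sum, Int.cast_sum, smul_eq_mul, one_div]
    exact ⟨mul_inv_cancel_left₀ three_ne_zero _, mul_inv_cancel_left₀ three_ne_zero _⟩
  have hs := sum_coords s
  rw [h, (sum_coords s').1, (sum_coords s').2] at hs
  exact Prod.ext (Int.cast_injective hs.1.symm) (Int.cast_injective hs.2.symm)

lemma coords_eq_of_mean_eq {s s' : G.toUC3P.Tuple} (hs : Is345 (coords s))
    (hs' : Is345 (coords s')) (h : G.toUC3P.mean s = G.toUC3P.mean s') : coords s = coords s' := by
  obtain ⟨σ, hσ⟩ := hs.exists_perm_of_sum_eq hs' (fun _ _ => G.three_le_dist _ _)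
    (sum_coords_eq_of_mean_eq h)
  funext c
  have hpart := G.part_eq _ _ (hσ c)
  rw [part_vert, part_vert] at hpart
  rw [hσ c, ← hpart]

lemma injOn_mean {S : Set G.toUC3P.Tuple} (hS : UC3P.IsPerfect S)
    (h345 : ∀ s ∈ S, Is345 (coords s)) (hjoint : ∀ s ∈ S, ∃ c, G.IsJoint (vert s c)) :
    S.InjOn G.toUC3P.mean := by
  intro s hs s' hs' h
  obtain ⟨c, hc⟩ := hjoint s hs
  have hloc := congrFun (coords_eq_of_mean_eq (h345 s hs) (h345 s' hs') h) c
  exact hS.eq_of_apply_eq hs hs' (Subtype.ext (G.eq_of_loc_eq_of_isJoint hc hloc))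

/-! ### From a matching to a perfect system of tuples -/

variable (G) in
/-- The labels of the triangles used for the matching `M`: the triples of `M`, for their triple
triangles, and all pairs, one of whose two triangles is used. -/
abbrev TriangleLabel (M : Set D.T) := M ⊕ Σ π : D.Edge, Fin (G.len π)

variable {M : Set D.T}

open Classical in
/-- The vertices of the triangle with a given label. A pair on a path to a triple of `M` contributes
its triangle at the start, any other pair its triangle at the finish. -/
noncomputable def triangle : G.TriangleLabel M → Fin 3 → G.Vertex
  | Sum.inl t => G.tripleVertex t.1
  | Sum.inr ⟨π, k⟩ => ![G.hor π k, G.ver π k, if π.1 ∈ M then G.start π k else G.finish π k]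

lemma triangle_is345 (l : G.TriangleLabel M) : Is345 fun a => G.loc (triangle l a) := by
  rcases l with t | ⟨π, k⟩
  · exact G.triple_triangle t.1
  · by_cases h : π.1 ∈ M
    · refine ⟨finRotate 3 |>.symm, ?_⟩
      simpa [triangle, h] using G.pair_start π k
    · refine ⟨Equiv.swap 0 2, ?_⟩
      simpa [triangle, h, Equiv.swap_apply_of_ne_of_ne] using G.pair_finish π k

lemma feasible_triangle (l : G.TriangleLabel M) :
    G.Feasible (triangle l 0) (triangle l 1) (triangle l 2) := by
  rcases l with t | ⟨π, k⟩
  · exact G.feasible_triple t.1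
  · obtain ⟨h₀₁, h₀₂, h₁₂⟩ := G.feasible_finish π k
    by_cases h : π.1 ∈ M
    · rw [part_finish_eq_start] at h₀₂ h₁₂
      simpa [triangle, h] using ⟨h₀₁, h₀₂, h₁₂⟩
    · simpa [triangle, h] using G.feasible_finish π k

lemma isJoint_triangle_two (l : G.TriangleLabel M) : G.IsJoint (triangle l 2) := by
  rcases l with t | ⟨π, k⟩
  · rfl
  · by_cases h : π.1 ∈ M
    · simpa [triangle, h] using G.isJoint_start π k
    · simp [triangle, h, TrianglePaths.IsJoint, TrianglePaths.finish]

lemma part_triangle_bijective (l : G.TriangleLabel M) :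
    Function.Bijective fun a => G.part (triangle l a) := by
  have injective_of_ne : ∀ f : Fin 3 → Fin 3,
      f 0 ≠ f 1 ∧ f 0 ≠ f 2 ∧ f 1 ≠ f 2 → Function.Injective f := by
    decide
  exact Finite.injective_iff_bijective.1 (injective_of_ne _ (feasible_triangle l))

/-- The numbering of the vertices of a triangle by the sets to which they belong. -/
noncomputable def partEquiv (l : G.TriangleLabel M) : Equiv.Perm (Fin 3) :=
  Equiv.ofBijective _ (part_triangle_bijective l)

/-- The tuple formed by the vertices of a triangle. -/
noncomputable def triangleTuple (l : G.TriangleLabel M) : G.toUC3P.Tuple := fun c =>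
  ⟨triangle l ((partEquiv l).symm c), (partEquiv l).apply_symm_apply c⟩

lemma vert_triangleTuple (l : G.TriangleLabel M) (a : Fin 3) :
    vert (triangleTuple l) (G.part (triangle l a)) = triangle l a :=
  congrArg (triangle l) ((partEquiv l).symm_apply_apply a)

lemma triangleTuple_is345 (l : G.TriangleLabel M) : Is345 (coords (triangleTuple l)) :=
  (triangle_is345 l).comp_perm (partEquiv l).symm

lemma cost_triangleTuple (l : G.TriangleLabel M) : G.toUC3P.cost (triangleTuple l) = 50 / 9 :=
  (cost_eq_fifty_div_nine_iff _).2 (triangleTuple_is345 l).sqSpread_eq_fifty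

open Classical in
/-- The label of the triangle that covers a vertex. -/
noncomputable def cover (hM : P3DM.IsMatching M) : G.Vertex → G.TriangleLabel M
  | Sum.inl e => Sum.inr ⟨hM.edge e, G.first _⟩
  | Sum.inr ⟨π, k, j⟩ =>
    if h : j = 2 ∧ π.1 ∈ M then
      if hk : k.1 + 1 < G.len π then Sum.inr ⟨π, k.1 + 1, hk⟩ else Sum.inl ⟨π.1, h.2⟩
    else Sum.inr ⟨π, k⟩

lemma cover_start (hM : P3DM.IsMatching M) {π : D.Edge} (hπ : π.1 ∈ M) (k : Fin (G.len π)) :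
    cover hM (G.start π k) = Sum.inr ⟨π, k⟩ := by
  obtain ⟨k, hk⟩ := k
  cases k with
  | zero =>
    refine (congrArg (cover hM) (G.start_first π)).trans ?_
    rw [cover, hM.edge_element hπ]
    rfl
  | succ k =>
    rw [G.start_succ (k := ⟨k, by omega⟩) rfl]
    exact (dif_pos ⟨rfl, hπ⟩).trans (dif_pos hk)

lemma cover_tripleVertex (hM : P3DM.IsMatching M) (t : M) (i : Fin 3) :
    cover hM (G.tripleVertex t.1 i) = Sum.inl t := by
  have hlast : ¬ (G.last (t.1, i)).1 + 1 < G.len (t.1, i) := by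
    simp only [TrianglePaths.last]
    omega
  exact (dif_pos ⟨rfl, t.2⟩).trans (dif_neg hlast)

lemma cover_triangle (hM : P3DM.IsMatching M) (l : G.TriangleLabel M) (a : Fin 3) :
    cover hM (triangle l a) = l := by
  rcases l with t | ⟨π, k⟩
  · exact cover_tripleVertex hM t a
  · fin_cases a
    · simp [triangle, TrianglePaths.hor, cover]
    · simp [triangle, TrianglePaths.ver, cover]
    · by_cases h : π.1 ∈ M
      · simpa [triangle, h] using cover_start hM h k
      · simp [triangle, h, TrianglePaths.finish, cover]

lemma exists_triangle_eq (hM : P3DM.IsMatching M) (v : G.Vertex) :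
    ∃ (l : G.TriangleLabel M) (a : Fin 3), triangle l a = v := by
  rcases v with e | ⟨π, k, j⟩
  · refine ⟨Sum.inr ⟨hM.edge e, G.first _⟩, 2, (if_pos (hM.edge_mem e)).trans ?_⟩
    rw [G.start_first, hM.element_edge]
  by_cases h : j = 2 ∧ π.1 ∈ M
  · obtain ⟨rfl, hπ⟩ := h
    by_cases hk : k.1 + 1 < G.len π
    · exact ⟨Sum.inr ⟨π, k.1 + 1, hk⟩, 2, (if_pos hπ).trans (G.start_succ rfl)⟩
    · have hlast : G.last π = k := Fin.ext (by simp only [TrianglePaths.last]; omega)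
      exact ⟨Sum.inl ⟨π.1, hπ⟩, π.2, congrArg (G.finish π) hlast⟩
  · refine ⟨Sum.inr ⟨π, k⟩, j, ?_⟩
    fin_cases j
    · rfl
    · rfl
    · exact if_neg fun hπ => h ⟨rfl, hπ⟩

theorem isPerfect_range_triangleTuple (hM : P3DM.IsMatching M) :
    UC3P.IsPerfect (Set.range (triangleTuple : G.TriangleLabel M → G.toUC3P.Tuple)) := by
  rintro c ⟨v, rfl⟩
  obtain ⟨l, a, rfl⟩ := exists_triangle_eq hM v
  refine ⟨triangleTuple l, ⟨⟨l, rfl⟩, Subtype.ext (vert_triangleTuple l a)⟩, ?_⟩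
  rintro _ ⟨⟨l', rfl⟩, hl'⟩
  have hcover := congrArg (fun p => cover hM p.1) hl'
  exact congrArg triangleTuple ((cover_triangle hM l' _).symm.trans
    (hcover.trans (cover_triangle hM l a)))

end TrianglePathGraph

end TrianglePaths

theorem theorem6 {X Y Z : Type*} [Fintype X] [Fintype Y] [Fintype Z]
    (D : P3DM X Y Z) (G : TrianglePathGraph D) :
    G.toUC3P.IsYes G.n (50 / 9) ↔ D.IsYes := by
  have isYes_iff := UC3P.isYes_n_iff_exists_isPerfect (U := G.toUC3P) (Φ := 50 / 9) (by norm_num)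
    TrianglePathGraph.fifty_div_nine_le_cost
  refine isYes_iff.trans (Iff.trans ⟨?_, ?_⟩ P3DM.isYes_iff_exists_isMatching.symm)
  · rintro ⟨S, hS, -, hcost⟩
    exact ⟨_, TrianglePathGraph.isMatching_of_isPerfect hS hcost⟩
  · rintro ⟨M, hM⟩
    have hS := TrianglePathGraph.isPerfect_range_triangleTuple (G := G) hM
    refine ⟨_, hS, TrianglePathGraph.injOn_mean hS ?_ ?_, ?_⟩ <;> rintro _ ⟨l, rfl⟩
    · exact TrianglePathGraph.triangleTuple_is345 l
    · exact ⟨_, TrianglePathGraph.vert_triangleTuple l 2 ▸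
        TrianglePathGraph.isJoint_triangle_two l⟩
    · exact TrianglePathGraph.cost_triangleTuple l
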